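/- Let $D$ be a knot diagram on the sphere with at least one crossing, and let its projection graph be the four-valent plane graph obtained by forgetting the over/under information (vertices are the crossings). Fix a checkerboard coloring of the faces of the projection graph, i.e. a coloring by black and white in which the two faces on the two sides of any edge have different colors. The Tait graph $G$ is the multigraph (loops and parallel edges allowed) whose vertices are the black faces and whose edges are the crossings, the edge of a crossing $c$ joining the faces at the two opposite black corners of $c$; the dual Tait graph $G^*$ is defined in the same way with the white faces. The overlaid Tait graph $\widehat\Gamma$ is the bipartite multigraph whose first vertex set is the set of crossings, whose second vertex set is the set of all faces (the vertices of $G$ and of $G^*$), and whose edges are the half-edges of $G$ and $G^*$, that is, the corners of the diagram, each corner joining its crossing to the face that contains it. Choose two faces $r$ and $s$ that lie on the two sides of some edge of the projection graph (equivalently, that lie on a common square face of $\widehat\Gamma$), named so that $r$ is black. The balanced overlaid Tait graph $\Gamma$ is obtained from $\widehat\Gamma$ by deleting the vertices $r$ and $s$. Then there is a bijection $\Phi$ from the set of perfect matchings of $\Gamma$ onto the set of spanning trees of $G$ rooted at the omitted vertex $r$. More precisely, $\Phi$ can be chosen such that for every perfect matching $M$: 1. a crossing $c$ is an edge of the tree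 $\Phi(M)$ if and only if $M$ matches $c$ with a black face; 2. if $M$ matches $c$ with a black face $v$ through a corner of $c$, then the face $u$ at the opposite corner of $c$ is joined to $r$ by a path in $\Phi(M)$ that does not use the edge $c$; that is, when the edges of $\Phi(M)$ are directed away from the root $r$, the edge $c$ is directed from $u$ to $v$. -/

import Mathlib

open scoped Graph

namespace Graph

variable {α β : Type*}

/-- Two vertices are joined by a walk. -/
def Reachable (G : Graph α β) (u v : α) : Prop := Relation.ReflTransGen G.Adj u v

/-- A multigraph has no cycle: there are no distinct vertices `v 0, …, v n` and distinct edges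
`e 0, …, e n` such that `e i` joins `v i` to `v (i + 1)`, indices taken modulo `n + 1`.
The case `n = 0` excludes loops, the case `n = 1` excludes pairs of parallel edges. -/
def IsAcyclic (G : Graph α β) : Prop :=
  ∀ (n : ℕ) (v : Fin (n + 1) → α) (e : Fin (n + 1) → β),
    Function.Injective v → Function.Injective e → ¬ ∀ i, G.IsLink (e i) (v i) (v (i + 1))

/-- A tree: a nonempty connected multigraph without cycles. -/
structure IsTree (T : Graph α β) : Prop where
  nonempty : V(T).Nonempty
  connected : ∀ u ∈ V(T), ∀ v ∈ V(T), T.Reachable u v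
  acyclic : T.IsAcyclic

/-- A rooted spanning tree of `G`: a subgraph of `G` that has all the vertices of `G` and is a
tree, together with a vertex of `G`, its root. -/
structure RootedSpanningTree (G : Graph α β) where
  tree : Graph α β
  root : α
  spanning : tree.IsSpanningSubgraph G
  isTree : tree.IsTree
  root_mem : root ∈ V(G)

/-- A perfect matching: a set of non-loop edges such that every vertex is an end of exactly one
of them. -/
structure IsPerfectMatching (G : Graph α β) (M : Set β) : Prop where
  subset : M ⊆ E(G)
  not_isLoopAt : ∀ e ∈ M, ∀ v, ¬ G.IsLoopAt e v
  existsUnique : ∀ v ∈ V(G), ∃! e, e ∈ M ∧ G.Inc e v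

end Graph

/-- A four-valent graph with a rotation system, on the finite set `H` of half-edges.
`rot x` is the half-edge that follows `x` counterclockwise around its crossing, and `flip x` is
the other half of the edge that contains `x`. -/
structure FourValentMap (H : Type*) where
  finite : Finite H
  rot : Equiv.Perm H
  flip : Equiv.Perm H
  rot_four : ∀ x, rot (rot (rot (rot x))) = x
  rot_two : ∀ x, rot (rot x) ≠ x
  flip_flip : ∀ x, flip (flip x) = x
  flip_ne : ∀ x, flip x ≠ x

namespace FourValentMap

variable {H : Type*} (P : FourValentMap H)

/-- The vertices of the graph: the cycles of the rotation. -/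
def Crossing : Type _ := Quotient (Equiv.Perm.SameCycle.setoid P.rot)

/-- The edges of the graph: pairs of half-edges. -/
def Edge : Type _ := Quotient (Equiv.Perm.SameCycle.setoid P.flip)

/-- The face permutation: walk along `x` with the face on the left, then continue along the
boundary of this face, that is, leave by the half-edge that precedes `flip x` around the crossing
which has been reached. -/
def facePerm : Equiv.Perm H := P.rot⁻¹ * P.flip

/-- The faces: the cycles of the face permutation. -/
def Face : Type _ := Quotient (Equiv.Perm.SameCycle.setoid P.facePerm)

/-- The crossing at which a half-edge starts. -/
def crossing (x : H) : P.Crossing := Quotient.mk _ x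

/-- The face to the left of a half-edge `x` (directed away from its crossing). It is the face
that contains the corner between `x` and `rot x`. The face to the right of `x` is
`face (flip x)`. -/
def face (x : H) : P.Face := Quotient.mk _ x

end FourValentMap

/-- A knot diagram (with at least one crossing) on the sphere, given combinatorially: its
projection graph, the over/under information, and the conditions that the rotation system is that
of a graph on the sphere (Euler's formula) and that there is a single component. -/
structure KnotDiagram (H : Type*) extends FourValentMap H where
  /-- `isOver x` says that `x` belongs to the over-strand of its crossing. -/
  isOver : H → Prop
  /-- Of the two strands through a crossing, one is over and the other is under. -/
  isOver_rot : ∀ x, isOver (rot x) ↔ ¬ isOver x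
  /-- Passing along edges and straight through crossings leads from any half-edge to any other. -/
  single_component : ∀ x y, ∃ g ∈ Subgroup.closure {rot ^ 2, flip}, g x = y
  /-- Euler's formula for the sphere. -/
  euler : (Nat.card toFourValentMap.Crossing : ℤ) - Nat.card toFourValentMap.Edge
    + Nat.card toFourValentMap.Face = 2

namespace KnotDiagram

variable {H : Type*} (D : KnotDiagram H)

/-- A checkerboard coloring: the faces on the two sides of every edge of the projection graph have
different colors. -/
structure Checkerboard where
  black : D.Face → Prop
  alternate : ∀ x, black (D.face (D.flip x)) ↔ ¬ black (D.face x)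

variable {D}

theorem face_flip_rot (x : H) : D.face (D.flip (D.rot x)) = D.face x :=
  Quotient.sound ⟨1, by simp [FourValentMap.facePerm, D.flip_flip]⟩

theorem Checkerboard.black_rot (C : D.Checkerboard) (x : H) :
    C.black (D.face (D.rot x)) ↔ ¬ C.black (D.face x) := by
  have h := C.alternate (D.rot x)
  rw [face_flip_rot] at h
  tauto

theorem crossing_rot (x : H) : D.crossing (D.rot x) = D.crossing x :=
  Quotient.sound ⟨-1, by simp⟩

theorem eq_of_crossing_eq {x y : H} (h : D.crossing x = D.crossing y) :
    y = x ∨ y = D.rot x ∨ y = D.rot (D.rot x) ∨ y = D.rot (D.rot (D.rot x)) := by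
  obtain ⟨k, hk⟩ : Equiv.Perm.SameCycle D.rot x y := Quotient.exact h
  have h4 : D.rot ^ (4 : ℤ) = 1 := by
    ext z
    exact D.rot_four z
  have hk' : (D.rot ^ (k % 4)) x = y := by
    rw [← hk]
    conv_rhs => rw [← Int.emod_add_mul_ediv k 4, zpow_add, zpow_mul, h4, one_zpow, mul_one]
  have h0 := Int.emod_nonneg k (show (4 : ℤ) ≠ 0 by norm_num)
  have h1 := Int.emod_lt_of_pos k (show (0 : ℤ) < 4 by norm_num)
  generalize k % 4 = m at *
  interval_cases m
  · left; exact hk'.symm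
  · right; left; exact hk'.symm
  · right; right; left; exact hk'.symm
  · right; right; right; exact hk'.symm

theorem Checkerboard.eq_of_crossing_eq (C : D.Checkerboard) {x y : H}
    (h : D.crossing x = D.crossing y) (hx : C.black (D.face x)) (hy : C.black (D.face y)) :
    y = x ∨ y = D.rot (D.rot x) := by
  have h1 := C.black_rot x
  have h2 := C.black_rot (D.rot x)
  have h3 := C.black_rot (D.rot (D.rot x))
  rcases KnotDiagram.eq_of_crossing_eq h with rfl | rfl | rfl | rfl <;> tauto

/-- The Tait graph: its vertices are the black faces and its edges are the crossings. The edge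
of a crossing joins the faces at the two opposite black corners of the crossing. It is a
multigraph, in general with loops and parallel edges. -/
def Checkerboard.taitGraph (C : D.Checkerboard) : Graph D.Face D.Crossing where
  vertexSet := {f | C.black f}
  IsLink c u v := ∃ x, D.crossing x = c ∧ C.black (D.face x) ∧
    u = D.face x ∧ v = D.face (D.rot (D.rot x))
  isLink_symm := by
    intro e _
    refine ⟨?_⟩
    rintro u v ⟨x, rfl, hx, rfl, rfl⟩
    refine ⟨D.rot (D.rot x), by rw [crossing_rot, crossing_rot], ?_, rfl, by rw [D.rot_four]⟩
    rw [C.black_rot, C.black_rot, not_not]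
    exact hx
  eq_or_eq_of_isLink_of_isLink := by
    rintro e u v u' v' ⟨x, rfl, hx, rfl, rfl⟩ ⟨y, hy, hby, rfl, rfl⟩
    rcases C.eq_of_crossing_eq hy.symm hx hby with rfl | rfl
    · exact Or.inl rfl
    · right
      rw [D.rot_four]
  left_mem_of_isLink := by
    rintro e u v ⟨x, rfl, hx, rfl, rfl⟩
    exact hx

variable (D)

/-- The overlaid Tait graph: its vertices are the crossings, which are the intersection points of
the edges of the Tait graph with those of the dual Tait graph, and all faces, which are the
vertices of the Tait graph (black) and of its dual (white). Its edges are the half-edges of both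
Tait graphs, that is, the corners of the diagram: the corner between `x` and `rot x` is an edge
from the crossing of `x` to the face that contains this corner. -/
def overlaidTaitGraph : Graph (D.Crossing ⊕ D.Face) H where
  vertexSet := Set.univ
  IsLink x a b := (a = Sum.inl (D.crossing x) ∧ b = Sum.inr (D.face x)) ∨
    (a = Sum.inr (D.face x) ∧ b = Sum.inl (D.crossing x))
  isLink_symm := by
    intro e _
    refine ⟨?_⟩
    intro a b h
    tauto
  eq_or_eq_of_isLink_of_isLink := by
    rintro e a b a' b' (⟨rfl, rfl⟩ | ⟨rfl, rfl⟩) (⟨rfl, rfl⟩ | ⟨rfl, rfl⟩) <;> simp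
  left_mem_of_isLink := by simp

/-- The balanced overlaid Tait graph: delete the vertices of two faces `r` and `s`. -/
def balancedOverlaidTaitGraph (r s : D.Face) : Graph (D.Crossing ⊕ D.Face) H :=
  D.overlaidTaitGraph.deleteVerts {Sum.inr r, Sum.inr s}

/-- The faces `r` and `s` lie on the two sides of some edge of the projection graph;
equivalently, they are the two face vertices of a square face of the overlaid Tait graph. -/
def OnSameSquare (r s : D.Face) : Prop := ∃ x, D.face x = r ∧ D.face (D.flip x) = s

end KnotDiagram

/-! A matching gives every black face except `r` a parent, the face at the opposite corner of its
matched crossing; likewise every white face except `s`, through the remaining crossings. The point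
is that no chain of parents runs into a cycle (`exists_level_of_isState`).

Let `K` be the set of crossings matched with black faces. Walking around the tree of black faces
whose chains end at `r`, one sees white faces that are either the same or joined by a crossing
outside `K`. Since `s` is seen from `r`, all of them have chains ending at `s` (`face_flip_mem_iff`,
`exists_level_face_flip`). With the colors exchanged the same holds, so the faces whose chains end
well are closed under crossing an edge; as the diagram is connected, these are all faces. Thus `K`
is a spanning tree (`IsBranching.isTree`), and the matching can be read off from it, because a tree
has one orientation away from a given root.

Conversely, for a spanning tree `K` the same walk shows that the white faces are connected through
the crossings outside `K`. Searching from `r` in `K` and from `s` in the complement gives one corner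
for each remaining face, at distinct crossings. Euler's formula makes the two numbers equal, so
every crossing is used (`exists_isState`). -/

namespace Graph

/-! ### Walks, cycles and distances in multigraphs. -/

variable {α β : Type*} {G : Graph α β} {c : β} {u v : α}

theorem Reachable.symm (h : G.Reachable u v) : G.Reachable v u := by
  induction h with
  | refl => exact .refl
  | tail _ h ih => exact .head h.symm ih

/-- The simple graph that has an edge for each pair of distinct adjacent vertices. -/
def simplification (G : Graph α β) : SimpleGraph α where
  Adj a b := a ≠ b ∧ G.Adj a b
  symm := ⟨fun _ _ h => ⟨h.1.symm, h.2.symm⟩⟩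
  loopless := ⟨fun _ h => h.1 rfl⟩

theorem Reachable.simplification (h : G.Reachable u v) : G.simplification.Reachable u v := by
  induction h with
  | refl => exact .refl _
  | @tail b w _ h ih =>
    by_cases hb : b = w
    · exact hb ▸ ih
    · exact ih.trans (SimpleGraph.Adj.reachable ⟨hb, h⟩)

/-- A simple path from `u` to `v` avoiding `c` would be closed to a cycle by `c`; a loop `c` is the
case of a path of length zero. -/
theorem IsAcyclic.not_reachable_deleteEdges (hG : G.IsAcyclic) (h : G.IsLink c u v) :
    ¬ (G.deleteEdges {c}).Reachable u v := by
  intro hr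
  obtain ⟨p, hp⟩ := hr.simplification.exists_isPath
  have hinj := hp.getVert_injOn
  have key : ∀ i, i < p.length → ∃ e, G.IsLink e (p.getVert i) (p.getVert (i + 1)) ∧ e ≠ c := by
    intro i hi
    obtain ⟨-, e, he⟩ := p.adj_getVert_succ hi
    refine ⟨e, he.mono deleteEdges_le, ?_⟩
    exact (deleteEdges_inc.1 he.inc_left).2
  have : Nonempty β := ⟨c⟩
  choose! e he hec using key
  -- A repeated edge would have the same two ends, but the path does not repeat vertices.
  have einj : ∀ i j, i < j → j < p.length → e i ≠ e j := by
    intro i j hij hj heq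
    have h1 := he i (by lia)
    rw [heq] at h1
    rcases (he j hj).left_eq_or_eq h1 with h2 | h2
    · have := hinj (by simp; lia) (by simp; lia) h2
      lia
    · rcases (he j hj).right_eq_or_eq h1 with h3 | h3
      · have := hinj (by simp; lia) (by simp; lia) h3
        lia
      · have := hinj (by simp; lia) (by simp; lia) h3
        lia
  -- The closing edge `c` takes the last index, whose successor wraps around to `0`.
  refine hG p.length (fun i => p.getVert i) (fun i => if (i : ℕ) < p.length then e i else c)
    ?_ ?_ ?_
  · intro i j hij
    exact Fin.ext (hinj (by simp; lia) (by simp; lia) hij)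
  · intro i j hij
    have hi := i.2
    have hj := j.2
    simp only at hij
    apply Fin.ext
    split_ifs at hij with h1 h2 h2
    · rcases lt_trichotomy (i : ℕ) j with h3 | h3 | h3
      · exact absurd hij (einj _ _ h3 h2)
      · exact h3
      · exact absurd hij.symm (einj _ _ h3 h1)
    · exact absurd hij (hec _ h1)
    · exact absurd hij.symm (hec _ h2)
    · lia
  · intro i
    by_cases hi : (i : ℕ) < p.length
    · have : ((i + 1 : Fin (p.length + 1)) : ℕ) = i + 1 :=
        Fin.val_add_one_of_lt (Fin.lt_def.2 (by simpa using hi))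
      simp only [hi, if_true, this]
      exact he _ hi
    · obtain rfl : i = Fin.last _ := Fin.ext (by simp; lia)
      simpa using h.symm

/-- Every vertex other than `r` that can be reached from `r` has a neighbour one step closer
to `r`. -/
theorem exists_distance (G : Graph α β) (r : α) : ∃ d : α → ℕ, ∀ v, G.Reachable r v → v ≠ r →
    ∃ e u, G.IsLink e v u ∧ G.Reachable r u ∧ d v = d u + 1 := by
  refine ⟨fun v => G.simplification.dist v r, fun v hv hvr => ?_⟩
  obtain ⟨p, hp⟩ := hv.symm.simplification.exists_walk_length_eq_dist
  cases p with
  | nil => exact absurd rfl hvr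
  | @cons _ u _ h p =>
    obtain ⟨e, he⟩ := h.2
    refine ⟨e, u, he, hv.tail ⟨e, he⟩, ?_⟩
    rw [SimpleGraph.Walk.length_cons] at hp
    have h1 := SimpleGraph.dist_le p
    obtain ⟨q, hq⟩ := p.reachable.exists_walk_length_eq_dist
    have h2 := SimpleGraph.dist_le (SimpleGraph.Walk.cons h q)
    rw [SimpleGraph.Walk.length_cons] at h2
    lia

end Graph

/-! ### Parent systems on the faces of one color. -/

namespace KnotDiagram

variable {H : Type*} {D : KnotDiagram H}

theorem face_rot_rot_rot (x : H) : D.face (D.rot (D.rot (D.rot x))) = D.face (D.flip x) := by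
  rw [← face_flip_rot, D.rot_four]

theorem finite_face (D : KnotDiagram H) : Finite D.Face :=
  haveI := D.finite
  inferInstanceAs (Finite (Quotient _))

theorem finite_crossing (D : KnotDiagram H) : Finite D.Crossing :=
  haveI := D.finite
  inferInstanceAs (Finite (Quotient _))

/-- The checkerboard coloring with the two colors interchanged. -/
def Checkerboard.swap (C : D.Checkerboard) : D.Checkerboard where
  black f := ¬ C.black f
  alternate x := not_congr (C.alternate x)

theorem Checkerboard.swap_swap (C : D.Checkerboard) : C.swap.swap = C := by
  cases C
  simp [Checkerboard.swap]

theorem Checkerboard.black_rot_rot (C : D.Checkerboard) (x : H) :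
    C.black (D.face (D.rot (D.rot x))) ↔ C.black (D.face x) := by
  rw [C.black_rot, C.black_rot, not_not]

theorem crossing_rot_rot (x : H) : D.crossing (D.rot (D.rot x)) = D.crossing x := by
  rw [crossing_rot, crossing_rot]

/-- A system of parent corners for the black faces: a set `A` of black corners at crossings in
`K`, at most one in each face and none in `r`. The corner `x ∈ A` declares the face at the
opposite corner of its crossing to be the parent of `face x`. -/
structure Checkerboard.IsBranching (C : D.Checkerboard) (r : D.Face) (K : Set D.Crossing)
    (A : Set H) : Prop where
  black : ∀ x ∈ A, C.black (D.face x)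
  crossing_mem : ∀ x ∈ A, D.crossing x ∈ K
  ne_root : ∀ x ∈ A, D.face x ≠ r
  eq_of_face_eq : ∀ x ∈ A, ∀ y ∈ A, D.face x = D.face y → x = y

/-- Every crossing in `K` has a corner in `A`. -/
def Checkerboard.Covers (C : D.Checkerboard) (K : Set D.Crossing) (A : Set H) : Prop :=
  ∀ x, C.black (D.face x) → D.crossing x ∈ K → x ∈ A ∨ D.rot (D.rot x) ∈ A

variable (D) in
/-- `Level A r n f` says that `r` is the `n`-fold parent of `f`. -/
inductive Level (A : Set H) (r : D.Face) : ℕ → D.Face → Prop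
  | zero : Level A r 0 r
  | succ {n : ℕ} {x : H} (hx : x ∈ A) (h : Level A r n (D.face (D.rot (D.rot x)))) :
      Level A r (n + 1) (D.face x)

namespace Checkerboard

variable {C : D.Checkerboard} {r s : D.Face} {K : Set D.Crossing} {A : Set H}

theorem IsBranching.level_parent (hA : C.IsBranching r K A) {n : ℕ} {x : H} (hx : x ∈ A)
    (h : D.Level A r n (D.face x)) :
    ∃ m, n = m + 1 ∧ D.Level A r m (D.face (D.rot (D.rot x))) := by
  generalize hf : D.face x = f at h
  cases h with
  | zero => exact absurd hf (hA.ne_root x hx)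
  | @succ m y hy h =>
    obtain rfl := hA.eq_of_face_eq x hx y hy hf
    exact ⟨m, rfl, h⟩

/-- Parents are unique and `r` has none, so a chain that arrives at `r` stops there. -/
theorem IsBranching.level_unique (hA : C.IsBranching r K A) {m n : ℕ} {f : D.Face}
    (hm : D.Level A r m f) (hn : D.Level A r n f) : m = n := by
  induction hm generalizing n with
  | zero =>
    generalize hf : r = f at hn
    cases hn with
    | zero => rfl
    | succ hx _ => exact absurd hf.symm (hf ▸ hA.ne_root _ hx)
  | succ hx _ ih =>
    obtain ⟨k, rfl, hk⟩ := hA.level_parent hx hn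
    rw [ih hk]

/-- Distinct levels are attained by distinct faces, and there are finitely many faces. -/
theorem IsBranching.exists_level_bound (hA : C.IsBranching r K A) :
    ∃ N, ∀ n f, D.Level A r n f → n ≤ N := by
  have := D.finite_face
  have hfin : {n | ∃ f, D.Level A r n f}.Finite := by
    choose g hg using fun n : {n | ∃ f, D.Level A r n f} => n.2
    refine Set.finite_coe_iff.1 (Finite.of_injective g fun m n h => Subtype.ext ?_)
    exact hA.level_unique (hg m) (h ▸ hg n)
  obtain ⟨N, hN⟩ := hfin.bddAbove
  exact ⟨N, fun n f h => hN ⟨f, h⟩⟩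

/-- A crossing in `K` joins a face to its parent, so passing through it moves one step up or down a
chain. -/
theorem Covers.level (hc : C.Covers K A) (hA : C.IsBranching r K A) {x : H}
    (hx : C.black (D.face x)) (hxK : D.crossing x ∈ K) (h : ∃ n, D.Level A r n (D.face x)) :
    ∃ n, D.Level A r n (D.face (D.rot (D.rot x))) := by
  obtain ⟨n, h⟩ := h
  rcases hc x hx hxK with hxA | hxA
  · obtain ⟨m, -, hm⟩ := hA.level_parent hxA h
    exact ⟨m, hm⟩
  · refine ⟨n + 1, .succ hxA ?_⟩
    rwa [D.rot_four]

end Checkerboard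

/-! ### Walking around a face and around a tree. -/

theorem facePerm_inv_apply (x : H) : D.facePerm⁻¹ x = D.flip (D.rot x) := by
  rw [Equiv.Perm.inv_eq_iff_eq]
  simp [FourValentMap.facePerm, D.flip_flip]

/-- Walking around a face, a property that persists at all corners but one is constant. -/
theorem iff_of_face_eq {Q : H → Prop} {x : H}
    (hQ : ∀ y, D.face y = D.face x → y ≠ x → (Q y ↔ Q (D.flip (D.rot y)))) {y : H}
    (hy : D.face y = D.face x) : Q y ↔ Q x := by
  have := D.finite
  have h : Equiv.Perm.SameCycle D.facePerm x y := Quotient.exact hy.symm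
  obtain ⟨k, -, rfl⟩ := h.exists_pow_eq'
  clear h hy
  induction k with
  | zero => rfl
  | succ k ih =>
    by_cases hx : (D.facePerm ^ (k + 1)) x = x
    · rw [hx]
    · rw [hQ _ (Quotient.sound (Equiv.Perm.SameCycle.symm ⟨k + 1, by simp [← zpow_natCast]⟩)) hx,
        ← facePerm_inv_apply, pow_succ', ← Equiv.Perm.mul_apply, inv_mul_cancel_left]
      exact ih

namespace Checkerboard

variable {C : D.Checkerboard} {r s : D.Face} {K : Set D.Crossing} {A : Set H}

section Circle

/-! Smooth every crossing so that the black corners of the crossings in `K` get joined and those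
of the other crossings get separated. The hypotheses on `Q` say that `Q` is constant on the
circles of the smoothing, where an edge is represented by its half with the black face on the
left. The conclusion is that the boundary of a tree is a single circle. -/

variable {Q : H → Prop}

/-- The circle follows the boundary of the face, with a detour around a whole subtree at each corner
leading to a child. Only the corner leading to the parent is not passed, and a cyclic walk can spare
one corner. -/
theorem IsBranching.iff_of_face_eq (hA : C.IsBranching r K A) (hc : C.Covers K A)
    (hQ : ∀ x, C.black (D.face x) → D.crossing x ∉ K → (Q x ↔ Q (D.flip (D.rot x))))
    (hQ' : ∀ x, C.black (D.face x) → D.crossing x ∈ K →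
      (Q (D.rot (D.rot x)) ↔ Q (D.flip (D.rot x))))
    {n : ℕ} {x y : H} (hb : C.black (D.face x)) (h : D.Level A r n (D.face x))
    (hy : D.face y = D.face x) : Q y ↔ Q x := by
  obtain ⟨N, hN⟩ := hA.exists_level_bound
  -- Downward induction on the level: `k` bounds how far `n` is below the levels that no longer
  -- occur.
  obtain ⟨k, hk⟩ : ∃ k, N < n + k := ⟨N + 1, by lia⟩
  induction k generalizing n x y with
  | zero => exact absurd (hN _ _ h) (by lia)
  | succ k ih =>
    have step : ∀ z, D.face z = D.face x → z ∉ A → (Q z ↔ Q (D.flip (D.rot z))) := by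
      intro z hz hzA
      by_cases hzK : D.crossing z ∈ K
      · have hzb : C.black (D.face z) := hz ▸ hb
        have hwA := (hc z hzb hzK).resolve_left hzA
        have hwb := hA.black _ hwA
        have hwl : D.Level A r (n + 1) (D.face (D.rot (D.rot z))) :=
          .succ hwA (by rwa [D.rot_four, hz])
        have h1 := ih (y := D.flip (D.rot (D.rot (D.rot z)))) hwb hwl (face_flip_rot _) (by lia)
        have h2 := hQ' _ hwb (hA.crossing_mem _ hwA)
        rw [D.rot_four] at h2
        rw [h2, h1, hQ' z hzb hzK]
      · exact hQ z (hz ▸ hb) hzK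
    by_cases hx : ∃ x₀ ∈ A, D.face x₀ = D.face x
    · obtain ⟨x₀, hx₀, hf⟩ := hx
      have hall : ∀ {w}, D.face w = D.face x₀ → (Q w ↔ Q x₀) :=
        KnotDiagram.iff_of_face_eq fun z hz hne => step z (hz.trans hf) fun hzA =>
          hne (hA.eq_of_face_eq z hzA x₀ hx₀ hz)
      rw [hall (hy.trans hf.symm), hall hf.symm]
    · exact KnotDiagram.iff_of_face_eq (fun z hz _ => step z hz fun hzA => hx ⟨z, hzA, hz⟩) hy

theorem IsBranching.iff_of_level (hA : C.IsBranching r K A) (hc : C.Covers K A)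
    (hQ : ∀ x, C.black (D.face x) → D.crossing x ∉ K → (Q x ↔ Q (D.flip (D.rot x))))
    (hQ' : ∀ x, C.black (D.face x) → D.crossing x ∈ K →
      (Q (D.rot (D.rot x)) ↔ Q (D.flip (D.rot x))))
    (hr : C.black r) {x₀ : H} (hx₀ : D.face x₀ = r) {n : ℕ} {x : H}
    (h : D.Level A r n (D.face x)) : Q x ↔ Q x₀ := by
  generalize hf : D.face x = f at h
  induction h generalizing x with
  | zero =>
    have h0 : D.Level A r 0 (D.face x₀) := by
      rw [hx₀]
      exact .zero
    exact hA.iff_of_face_eq hc hQ hQ' (hx₀ ▸ hr) h0 (hf.trans hx₀.symm)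
  | @succ n y hy h ih =>
    have hyb := hA.black y hy
    have hyK := hA.crossing_mem y hy
    -- At the parent edge the smoothing leads from the boundary of the child to that of its parent.
    have h1 := hQ' (D.rot (D.rot y)) ((C.black_rot_rot y).2 hyb) (by rwa [crossing_rot_rot])
    rw [D.rot_four] at h1
    rw [hA.iff_of_face_eq hc hQ hQ' hyb (.succ hy h) hf, h1]
    exact ih (face_flip_rot _)

end Circle

/-- The set `S` is a union of components of the dual graph of the crossings outside `K`. Either
all faces across an edge from a face of the tree belong to `S`, or none. -/
theorem IsBranching.face_flip_mem_iff (hA : C.IsBranching r K A) (hc : C.Covers K A)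
    {S : Set D.Face} (hS : ∀ x, ¬ C.black (D.face x) → D.crossing x ∉ K → D.face x ∈ S →
      D.face (D.rot (D.rot x)) ∈ S)
    (hr : C.black r) {x₀ : H} (hx₀ : D.face x₀ = r) {n : ℕ} {x : H}
    (h : D.Level A r n (D.face x)) : D.face (D.flip x) ∈ S ↔ D.face (D.flip x₀) ∈ S := by
  -- Outside `K` the two white faces compared lie at opposite corners of the crossing, so `hS`
  -- applies in both directions; in `K` they are the same face.
  refine hA.iff_of_level (Q := fun x => D.face (D.flip x) ∈ S) hc ?_ ?_ hr hx₀ h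
  · intro y hy hyK
    simp only [D.flip_flip]
    rw [← face_rot_rot_rot]
    have hb : ¬ C.black (D.face (D.rot y)) := by rwa [C.black_rot, not_not]
    have hyK' : D.crossing (D.rot y) ∉ K := by rwa [crossing_rot]
    refine ⟨fun h => ?_, hS _ hb hyK'⟩
    have := hS _ (by rwa [C.black_rot_rot]) (by rwa [crossing_rot_rot]) h
    rwa [D.rot_four] at this
  · intro y _ _
    simp only [D.flip_flip]
    rw [face_flip_rot]

end Checkerboard

end KnotDiagram

/-! ### Parent systems and spanning trees of the Tait graph. -/

namespace KnotDiagram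

variable {H : Type*} {D : KnotDiagram H}

namespace Checkerboard

variable {C : D.Checkerboard} {r s : D.Face} {K : Set D.Crossing} {A : Set H}

theorem exists_black_corner (C : D.Checkerboard) (c : D.Crossing) :
    ∃ x, D.crossing x = c ∧ C.black (D.face x) := by
  obtain ⟨x, rfl⟩ : ∃ x, D.crossing x = c := Quotient.exists_rep c
  by_cases hx : C.black (D.face x)
  · exact ⟨x, rfl, hx⟩
  · exact ⟨D.rot x, crossing_rot x, (C.black_rot x).2 hx⟩

theorem edgeSet_taitGraph (C : D.Checkerboard) : E(C.taitGraph) = Set.univ := by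
  refine Set.eq_univ_of_forall fun c => ?_
  obtain ⟨x, hx, hb⟩ := C.exists_black_corner c
  exact Graph.IsLink.edge_mem (G := C.taitGraph) ⟨x, hx, hb, rfl, rfl⟩

theorem edgeSet_restrict_taitGraph (C : D.Checkerboard) (K : Set D.Crossing) :
    E(C.taitGraph.restrict K) = K := by
  simp [edgeSet_taitGraph]

theorem restrict_isLink {x : H} (hx : C.black (D.face x)) (hxK : D.crossing x ∈ K) :
    (C.taitGraph.restrict K).IsLink (D.crossing x) (D.face x) (D.face (D.rot (D.rot x))) := by
  rw [Graph.restrict_isLink]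
  exact ⟨hxK, x, rfl, hx, rfl, rfl⟩

theorem restrict_isSpanningSubgraph (C : D.Checkerboard) (K : Set D.Crossing) :
    (C.taitGraph.restrict K).IsSpanningSubgraph C.taitGraph where
  le := Graph.restrict_le
  vertexSet_eq := rfl

/-- Two black corners at one crossing are opposite, so each face would be the parent of the other,
and two steps up would not change the level. -/
theorem IsBranching.crossing_ne (hA : C.IsBranching r K A) {x y : H} (hx : x ∈ A) (hy : y ∈ A)
    {n : ℕ} (h : D.Level A r n (D.face x)) (hxy : x ≠ y) : D.crossing x ≠ D.crossing y := by
  intro hc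
  obtain rfl := (C.eq_of_crossing_eq hc (hA.black x hx) (hA.black y hy)).resolve_left hxy.symm
  obtain ⟨m, rfl, hm⟩ := hA.level_parent hx h
  obtain ⟨k, rfl, hk⟩ := hA.level_parent hy hm
  rw [D.rot_four] at hk
  have := hA.level_unique hk h
  lia

/-- The path from `r` to a face of lower level does not use the parent edge of `face x`. -/
theorem IsBranching.reachable_of_level_lt (hA : C.IsBranching r K A) {x : H} (hx : x ∈ A)
    {m n : ℕ} {f : D.Face} (hm : D.Level A r m (D.face x)) (hn : D.Level A r n f) (h : n < m) :
    ((C.taitGraph.restrict K).deleteEdges {D.crossing x}).Reachable r f := by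
  induction hn with
  | zero => exact .refl
  | @succ n y hy hl ih =>
    refine (ih (by lia)).tail ⟨D.crossing y, ?_⟩
    rw [Graph.deleteEdges_isLink]
    refine ⟨(restrict_isLink (hA.black y hy) (hA.crossing_mem y hy)).symm, fun hc => ?_⟩
    refine hA.crossing_ne hy hx (.succ hy hl) ?_ hc
    rintro rfl
    have := hA.level_unique hm (.succ hy hl)
    lia

theorem IsBranching.reachable_parent (hA : C.IsBranching r K A) {x : H} (hx : x ∈ A)
    (h : ∃ n, D.Level A r n (D.face x)) :
    ((C.taitGraph.restrict K).deleteEdges {D.crossing x}).Reachable r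
      (D.face (D.rot (D.rot x))) := by
  obtain ⟨n, hn⟩ := h
  obtain ⟨m, rfl, hm⟩ := hA.level_parent hx hn
  exact hA.reachable_of_level_lt hx hn hm (by lia)

theorem IsBranching.reachable (hA : C.IsBranching r K A) {n : ℕ} {f : D.Face}
    (h : D.Level A r n f) : (C.taitGraph.restrict K).Reachable r f := by
  induction h with
  | zero => exact .refl
  | @succ n y hy hl ih =>
    exact ih.tail ⟨_, (restrict_isLink (hA.black y hy) (hA.crossing_mem y hy)).symm⟩

/-- A branching that reaches all black faces is a spanning tree of the Tait graph. -/
theorem IsBranching.isTree (hA : C.IsBranching r K A) (hc : C.Covers K A) (hr : C.black r)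
    (h : ∀ f, C.black f → ∃ n, D.Level A r n f) : (C.taitGraph.restrict K).IsTree where
  nonempty := ⟨r, hr⟩
  connected u hu v hv := by
    obtain ⟨m, hm⟩ := h u hu
    obtain ⟨n, hn⟩ := h v hv
    exact (hA.reachable hm).symm.trans (hA.reachable hn)
  acyclic := by
    intro n v e hv he hl
    have hb : ∀ i, C.black (v i) := fun i => (hl i).left_mem
    choose d hd using fun i => h (v i) (hb i)
    -- Each edge is the parent edge of its end of higher level.
    have parent : ∀ i, ∃ x ∈ A, D.crossing x = e i ∧
        ((D.face x = v i ∧ d i = d (i + 1) + 1) ∨ (D.face x = v (i + 1) ∧ d (i + 1) = d i + 1)) := by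
      intro i
      obtain ⟨hK, x, hx, hxb, h1, h2⟩ := (Graph.restrict_isLink _ _ _ _ _).mp (hl i)
      rcases hc x hxb (hx ▸ hK) with hxA | hxA
      · refine ⟨x, hxA, hx, .inl ⟨h1.symm, ?_⟩⟩
        obtain ⟨m, hm, hm'⟩ := hA.level_parent hxA (h1 ▸ hd i)
        rw [hm, hA.level_unique hm' (h2 ▸ hd (i + 1))]
      · refine ⟨_, hxA, by rw [crossing_rot_rot, hx], .inr ⟨h2.symm, ?_⟩⟩
        obtain ⟨m, hm, hm'⟩ := hA.level_parent hxA (h2 ▸ hd (i + 1))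
        rw [D.rot_four] at hm'
        rw [hm, hA.level_unique hm' (h1 ▸ hd i)]
    -- Both edges of the cycle at a vertex of highest level must be its parent edge, so they
    -- coincide.
    obtain ⟨i, hi⟩ := Finite.exists_max d
    obtain ⟨x, hxA, hxe, ⟨hx, hxd⟩ | ⟨-, hxd⟩⟩ := parent i
    swap
    · have := hi (i + 1)
      lia
    obtain ⟨y, hyA, hye, ⟨-, hyd⟩ | ⟨hy, hyd⟩⟩ := parent (i - 1)
    · have := hi (i - 1)
      rw [sub_add_cancel] at hyd
      lia
    rw [sub_add_cancel] at hy
    obtain rfl := hA.eq_of_face_eq x hxA y hyA (hx.trans hy.symm)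
    have hii := he (hxe.symm.trans hye)
    rw [sub_add_cancel, ← hii] at hyd
    lia

/-- A breadth-first search in a connected spanning subgraph of the Tait graph. -/
theorem exists_isBranching
    (h : ∀ f, C.black f → (C.taitGraph.restrict K).Reachable r f) :
    ∃ A, C.IsBranching r K A ∧ (∀ f, C.black f → f ≠ r → ∃ x ∈ A, D.face x = f) ∧
      ∀ f, C.black f → ∃ n, D.Level A r n f := by
  obtain ⟨d, hd⟩ := (C.taitGraph.restrict K).exists_distance r
  have key : ∀ f : {f // C.black f ∧ f ≠ r}, ∃ x, D.face x = f ∧ D.crossing x ∈ K ∧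
      d f = d (D.face (D.rot (D.rot x))) + 1 := by
    rintro ⟨f, hf, hfr⟩
    obtain ⟨e, u, hl, -, hdu⟩ := hd f (h f hf) hfr
    obtain ⟨hK, x, rfl, -, rfl, rfl⟩ := (Graph.restrict_isLink _ _ _ _ _).mp hl
    exact ⟨x, rfl, hK, hdu⟩
  choose p hpf hpK hpd using key
  refine ⟨Set.range p, ⟨?_, ?_, ?_, ?_⟩, fun f hf hfr => ⟨_, ⟨⟨f, hf, hfr⟩, rfl⟩, hpf _⟩, ?_⟩
  · rintro _ ⟨f, rfl⟩
    exact (hpf f).symm ▸ f.2.1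
  · rintro _ ⟨f, rfl⟩
    exact hpK f
  · rintro _ ⟨f, rfl⟩
    exact (hpf f).symm ▸ f.2.2
  · rintro _ ⟨f, rfl⟩ _ ⟨g, rfl⟩ hfg
    rw [hpf, hpf] at hfg
    rw [Subtype.ext hfg]
  · intro f hf
    induction hn : d f using Nat.strong_induction_on generalizing f with
    | _ n ih =>
      by_cases hfr : f = r
      · rw [hfr]
        exact ⟨0, .zero⟩
      · have h1 := hpd ⟨f, hf, hfr⟩
        have h2 := hpf ⟨f, hf, hfr⟩
        simp only at h1 h2
        obtain ⟨m, hm⟩ := ih (d (D.face (D.rot (D.rot (p ⟨f, hf, hfr⟩))))) (by lia) _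
          ((C.black_rot_rot _).2 (h2.symm ▸ hf)) rfl
        have := Level.succ (Set.mem_range_self _) hm
        exact ⟨m + 1, h2 ▸ this⟩

/-- The edges of a tree are the parent edges of its vertices. -/
theorem IsBranching.covers (hA : C.IsBranching r K A)
    (hT : (C.taitGraph.restrict K).IsAcyclic) (h : ∀ f, C.black f → ∃ n, D.Level A r n f) :
    C.Covers K A := by
  intro x hx hxK
  by_contra! hn
  -- If the edge of `x` is no parent edge, all chains to `r` avoid it, so its ends stay connected
  -- without it.
  have reach : ∀ n f, D.Level A r n f →
      ((C.taitGraph.restrict K).deleteEdges {D.crossing x}).Reachable r f := by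
    intro n f hf
    induction hf with
    | zero => exact .refl
    | @succ n y hy hl ih =>
      refine ih.tail ⟨D.crossing y, ?_⟩
      rw [Graph.deleteEdges_isLink]
      refine ⟨(restrict_isLink (hA.black y hy) (hA.crossing_mem y hy)).symm, fun hc => ?_⟩
      rcases C.eq_of_crossing_eq (Eq.symm hc) hx (hA.black y hy) with rfl | rfl
      · exact hn.1 hy
      · exact hn.2 hy
  obtain ⟨m, hm⟩ := h _ hx
  obtain ⟨n, hn⟩ := h _ ((C.black_rot_rot x).2 hx)
  exact hT.not_reachable_deleteEdges (restrict_isLink hx hxK)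
    ((reach _ _ hm).symm.trans (reach _ _ hn))

/-- The complement of a spanning tree of the Tait graph is connected in the dual. -/
theorem IsBranching.reachable_dual (hA : C.IsBranching r K A) (hc : C.Covers K A)
    (hr : C.black r) (h : ∀ f, C.black f → ∃ n, D.Level A r n f) (hrs : D.OnSameSquare r s)
    {f : D.Face} (hf : ¬ C.black f) : (C.swap.taitGraph.restrict Kᶜ).Reachable s f := by
  obtain ⟨x₀, hx₀, rfl⟩ := hrs
  obtain ⟨y, rfl⟩ : ∃ y, D.face y = f := Quotient.exists_rep f
  have hy : C.black (D.face (D.flip y)) := (C.alternate y).2 hf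
  obtain ⟨n, hn⟩ := h _ hy
  have := hA.face_flip_mem_iff (S := {f | (C.swap.taitGraph.restrict Kᶜ).Reachable
    (D.face (D.flip x₀)) f}) hc (fun x hx hxK hs => hs.tail ⟨_, restrict_isLink (C := C.swap) hx hxK⟩)
    hr hx₀ hn
  rw [D.flip_flip] at this
  exact this.2 .refl

end Checkerboard

end KnotDiagram

/-! ### Counting crossings, edges and faces. -/

theorem Equiv.Perm.card_eq_card_quotient_mul {α : Type*} (σ : Equiv.Perm α) {n : ℕ} (hn : 0 < n)
    (h1 : σ ^ n = 1) (h2 : ∀ x k, 0 < k → k < n → (σ ^ k) x ≠ x) :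
    Nat.card α = Nat.card (Quotient (Equiv.Perm.SameCycle.setoid σ)) * n := by
  rw [← Nat.card_fin n, ← Nat.card_prod]
  symm
  refine Nat.card_eq_of_bijective (fun p => (σ ^ (p.2 : ℕ)) p.1.out) ⟨?_, fun x => ?_⟩
  · have key : ∀ (x : α) (i j : Fin n), (σ ^ (i : ℕ)) x = (σ ^ (j : ℕ)) x → ¬ i < j := by
      intro x i j h hij
      refine h2 x (j - i) (Nat.sub_pos_of_lt hij) (by lia) ((σ ^ (i : ℕ)).injective ?_)
      rw [← Equiv.Perm.mul_apply, ← pow_add, Nat.add_sub_cancel' (le_of_lt hij), h]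
    rintro ⟨p, i⟩ ⟨q, j⟩ h
    simp only at h
    obtain rfl : p = q := by
      rw [← p.out_eq, ← q.out_eq]
      refine Quotient.sound (?_ : σ.SameCycle _ _)
      rw [← Equiv.Perm.sameCycle_pow_left (n := i), h, Equiv.Perm.sameCycle_pow_left]
    rcases lt_trichotomy i j with hij | rfl | hij
    · exact absurd hij (key _ _ _ h)
    · rfl
    · exact absurd hij (key _ _ _ h.symm)
  · obtain ⟨k, hk⟩ : σ.SameCycle (Quotient.mk (Equiv.Perm.SameCycle.setoid σ) x).out x :=
      Quotient.mk_out (s := Equiv.Perm.SameCycle.setoid σ) x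
    have hn' : (n : ℤ) ≠ 0 := by lia
    have hk0 := Int.emod_nonneg k hn'
    have hk1 := Int.emod_lt_of_pos k (show (0 : ℤ) < n by lia)
    refine ⟨(Quotient.mk _ x, ⟨(k % n).toNat, by lia⟩), ?_⟩
    conv_rhs => rw [← hk, ← Int.emod_add_mul_ediv k n, zpow_add, zpow_mul, zpow_natCast, h1,
      one_zpow, mul_one]
    simp only
    rw [← zpow_natCast, Int.toNat_of_nonneg hk0]

namespace KnotDiagram

variable {H : Type*} {D : KnotDiagram H}

/-- Counting half-edges at crossings and on edges gives twice as many edges as crossings; the rest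
is Euler's formula. -/
theorem card_face (D : KnotDiagram H) : Nat.card D.Face = Nat.card D.Crossing + 2 := by
  have h1 : Nat.card H = Nat.card D.Edge * 2 := by
    refine D.flip.card_eq_card_quotient_mul two_pos (Equiv.ext D.flip_flip) fun x k h1 h2 => ?_
    obtain rfl : k = 1 := by lia
    exact D.flip_ne x
  have h2 : Nat.card H = Nat.card D.Crossing * 4 := by
    refine D.rot.card_eq_card_quotient_mul four_pos (Equiv.ext D.rot_four) fun x k h1 h2 => ?_
    interval_cases k
    · intro h
      exact D.rot_two x (by rw [pow_one] at h; rw [h, h])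
    · exact D.rot_two x
    · intro (h : D.rot (D.rot (D.rot x)) = x)
      have h' := D.rot_four x
      rw [h] at h'
      exact D.rot_two x (by rw [h', h'])
  have := D.euler
  lia

/-! ### Perfect matchings as sets of corners. -/

/-- Perfect matchings of the balanced overlaid Tait graph in terms of corners: every crossing and
every face other than `r` and `s` has exactly one corner in `M`, and `r` and `s` have none. -/
structure IsState (D : KnotDiagram H) (r s : D.Face) (M : Set H) : Prop where
  ne : ∀ x ∈ M, D.face x ≠ r ∧ D.face x ≠ s
  crossing : ∀ c, ∃! x, x ∈ M ∧ D.crossing x = c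
  face : ∀ f, f ≠ r → f ≠ s → ∃! x, x ∈ M ∧ D.face x = f

variable {r s : D.Face} {M : Set H}

theorem balancedOverlaidTaitGraph_isLink {x : H} {a b : D.Crossing ⊕ D.Face} :
    (D.balancedOverlaidTaitGraph r s).IsLink x a b ↔ (D.face x ≠ r ∧ D.face x ≠ s) ∧
      ((a = Sum.inl (D.crossing x) ∧ b = Sum.inr (D.face x)) ∨
        (a = Sum.inr (D.face x) ∧ b = Sum.inl (D.crossing x))) := by
  simp only [balancedOverlaidTaitGraph, Graph.deleteVerts_isLink, overlaidTaitGraph]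
  constructor
  · rintro ⟨⟨rfl, rfl⟩ | ⟨rfl, rfl⟩, h1, h2⟩ <;> simp_all
  · rintro ⟨h, ⟨rfl, rfl⟩ | ⟨rfl, rfl⟩⟩ <;> simp_all

theorem balancedOverlaidTaitGraph_inc_inl {x : H} {c : D.Crossing} :
    (D.balancedOverlaidTaitGraph r s).Inc x (Sum.inl c) ↔
      (D.face x ≠ r ∧ D.face x ≠ s) ∧ D.crossing x = c := by
  simp [Graph.Inc, balancedOverlaidTaitGraph_isLink, eq_comm]

theorem balancedOverlaidTaitGraph_inc_inr {x : H} {f : D.Face} :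
    (D.balancedOverlaidTaitGraph r s).Inc x (Sum.inr f) ↔
      (D.face x ≠ r ∧ D.face x ≠ s) ∧ D.face x = f := by
  simp [Graph.Inc, balancedOverlaidTaitGraph_isLink, eq_comm]

theorem isPerfectMatching_iff_isState :
    (D.balancedOverlaidTaitGraph r s).IsPerfectMatching M ↔ D.IsState r s M := by
  have hne : ∀ x, x ∈ E(D.balancedOverlaidTaitGraph r s) ↔ D.face x ≠ r ∧ D.face x ≠ s := by
    intro x
    rw [Graph.edge_mem_iff_exists_isLink]
    simp only [balancedOverlaidTaitGraph_isLink]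
    exact ⟨fun ⟨_, _, h, _⟩ => h, fun h => ⟨_, _, h, .inl ⟨rfl, rfl⟩⟩⟩
  have hV : V(D.balancedOverlaidTaitGraph r s) = {Sum.inr r, Sum.inr s}ᶜ := by
    simp [balancedOverlaidTaitGraph, overlaidTaitGraph, Set.compl_eq_univ_sdiff]
  constructor
  · intro h
    have hM : ∀ x ∈ M, D.face x ≠ r ∧ D.face x ≠ s := fun x hx => (hne x).1 (h.subset hx)
    refine ⟨hM, fun c => ?_, fun f hr hs => ?_⟩
    · obtain ⟨x, ⟨hx, hi⟩, hu⟩ := h.existsUnique (Sum.inl c) (by simp [hV])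
      refine ⟨x, ⟨hx, (balancedOverlaidTaitGraph_inc_inl.1 hi).2⟩, fun y hy => hu y ⟨hy.1, ?_⟩⟩
      exact balancedOverlaidTaitGraph_inc_inl.2 ⟨hM y hy.1, hy.2⟩
    · obtain ⟨x, ⟨hx, hi⟩, hu⟩ := h.existsUnique (Sum.inr f) (by simp [hV, hr, hs])
      refine ⟨x, ⟨hx, (balancedOverlaidTaitGraph_inc_inr.1 hi).2⟩, fun y hy => hu y ⟨hy.1, ?_⟩⟩
      exact balancedOverlaidTaitGraph_inc_inr.2 ⟨hM y hy.1, hy.2⟩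
  · intro h
    refine ⟨fun x hx => (hne x).2 (h.ne x hx), fun x _ v hv => ?_, fun v hv => ?_⟩
    · rcases (balancedOverlaidTaitGraph_isLink.1 hv).2 with ⟨rfl, h⟩ | ⟨rfl, h⟩ <;> cases h
    · cases v with
      | inl c =>
        obtain ⟨x, ⟨hx, hi⟩, hu⟩ := h.crossing c
        refine ⟨x, ⟨hx, balancedOverlaidTaitGraph_inc_inl.2 ⟨h.ne x hx, hi⟩⟩, fun y hy => ?_⟩
        exact hu y ⟨hy.1, (balancedOverlaidTaitGraph_inc_inl.1 hy.2).2⟩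
      | inr f =>
        rw [hV] at hv
        obtain ⟨x, ⟨hx, hi⟩, hu⟩ := h.face f (by rintro rfl; simp at hv) (by rintro rfl; simp at hv)
        refine ⟨x, ⟨hx, balancedOverlaidTaitGraph_inc_inr.2 ⟨h.ne x hx, hi⟩⟩, fun y hy => ?_⟩
        exact hu y ⟨hy.1, (balancedOverlaidTaitGraph_inc_inr.1 hy.2).2⟩

theorem IsState.symm (h : D.IsState r s M) : D.IsState s r M :=
  ⟨fun x hx => (h.ne x hx).symm, h.crossing, fun f hs hr => h.face f hr hs⟩

theorem OnSameSquare.symm (h : D.OnSameSquare r s) : D.OnSameSquare s r := by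
  obtain ⟨x, rfl, rfl⟩ := h
  exact ⟨D.flip x, rfl, by rw [D.flip_flip]⟩

theorem Checkerboard.not_black_of_onSameSquare (C : D.Checkerboard) (h : D.OnSameSquare r s)
    (hr : C.black r) : ¬ C.black s := by
  obtain ⟨x, rfl, rfl⟩ := h
  rw [C.alternate, not_not]
  exact hr

/-! ### From states to trees and back. -/

namespace Checkerboard

variable {C : D.Checkerboard}

/-- The crossings that are matched with a black face. -/
def matchedCrossings (C : D.Checkerboard) (M : Set H) : Set D.Crossing :=
  {c | ∃ x ∈ M, D.crossing x = c ∧ C.black (D.face x)}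

/-- The black corners in `M`. -/
def blackCorners (C : D.Checkerboard) (M : Set H) : Set H :=
  {x | x ∈ M ∧ C.black (D.face x)}

theorem isBranching_of_isState (C : D.Checkerboard) (hM : D.IsState r s M) :
    C.IsBranching r (C.matchedCrossings M) (C.blackCorners M) where
  black _ hx := hx.2
  crossing_mem x hx := ⟨x, hx.1, rfl, hx.2⟩
  ne_root x hx := (hM.ne x hx.1).1
  eq_of_face_eq x hx _ hy h :=
    (hM.face _ (hM.ne x hx.1).1 (hM.ne x hx.1).2).unique ⟨hx.1, rfl⟩ ⟨hy.1, h.symm⟩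

theorem covers_blackCorners (C : D.Checkerboard) (M : Set H) :
    C.Covers (C.matchedCrossings M) (C.blackCorners M) := by
  rintro x hx ⟨y, hy, hc, hyb⟩
  rcases C.eq_of_crossing_eq hc.symm hx hyb with rfl | rfl
  · exact .inl ⟨hy, hyb⟩
  · exact .inr ⟨hy, hyb⟩

/-- This makes the two colors interchangeable in all later arguments. -/
theorem matchedCrossings_swap (C : D.Checkerboard) (hM : D.IsState r s M) :
    C.swap.matchedCrossings M = (C.matchedCrossings M)ᶜ := by
  ext c
  obtain ⟨x, ⟨hx, rfl⟩, hu⟩ := hM.crossing c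
  constructor
  · rintro ⟨y, hy, hc, hyb⟩ ⟨z, hz, hc', hzb⟩
    obtain rfl := hu y ⟨hy, hc⟩
    obtain rfl := hu z ⟨hz, hc'⟩
    exact hyb hzb
  · intro hn
    exact ⟨x, hx, rfl, fun hb => hn ⟨x, hx, rfl, hb⟩⟩

/-- A black face that is joined to `r` lies across every edge from white faces joined to `s`. -/
theorem exists_level_face_flip (C : D.Checkerboard) (hM : D.IsState r s M)
    (hrs : D.OnSameSquare r s) (hr : C.black r) {x : H}
    (h : ∃ n, D.Level (C.blackCorners M) r n (D.face x)) :
    ∃ n, D.Level (C.swap.blackCorners M) s n (D.face (D.flip x)) := by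
  obtain ⟨n, hn⟩ := h
  obtain ⟨x₀, hx₀, rfl⟩ := hrs
  refine ((C.isBranching_of_isState hM).face_flip_mem_iff (C.covers_blackCorners M)
    (S := {f | ∃ n, D.Level (C.swap.blackCorners M) (D.face (D.flip x₀)) n f})
    ?_ hr hx₀ hn).2 ⟨0, .zero⟩
  intro y hy hyK hl
  refine (C.swap.covers_blackCorners M).level (C.swap.isBranching_of_isState hM.symm) hy ?_ hl
  rw [C.matchedCrossings_swap hM]
  exact hyK

theorem exists_level_of_isState (C : D.Checkerboard) (hM : D.IsState r s M)
    (hrs : D.OnSameSquare r s) (hr : C.black r) {f : D.Face} (hf : C.black f) :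
    ∃ n, D.Level (C.blackCorners M) r n f := by
  have hs := C.not_black_of_onSameSquare hrs hr
  have hw : ∀ {n f}, D.Level (C.swap.blackCorners M) s n f → ¬ C.black f := by
    intro n f h
    cases h with
    | zero => exact hs
    | succ hx _ => exact hx.2
  -- `Z` will be shown invariant under `flip` and `rot ^ 2`, which act transitively together.
  let Z : H → Prop := fun x => (∃ n, D.Level (C.blackCorners M) r n (D.face x)) ∨
    ∃ n, D.Level (C.swap.blackCorners M) s n (D.face x)
  have hflip : ∀ x, Z x → Z (D.flip x) := by
    rintro x (h | h)
    · exact .inr (C.exists_level_face_flip hM hrs hr h)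
    · left
      have := C.swap.exists_level_face_flip hM.symm hrs.symm hs h
      rwa [C.swap_swap] at this
  have hrot3 : ∀ x, Z x → Z (D.rot (D.rot (D.rot x))) := by
    intro x h
    have := hflip x h
    simp only [Z] at this ⊢
    rwa [face_rot_rot_rot]
  -- Six quarter turns are two.
  have hrot2 : ∀ x, Z x → Z (D.rot (D.rot x)) := by
    intro x h
    have := hrot3 _ (hrot3 x h)
    rwa [D.rot_four] at this
  obtain ⟨x₀, hx₀, -⟩ := id hrs
  obtain ⟨x, rfl⟩ : ∃ x, D.face x = f := Quotient.exists_rep f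
  have hZ₀ : Z x₀ := .inl ⟨0, hx₀ ▸ .zero⟩
  have hall : ∀ g ∈ Subgroup.closure {D.rot ^ 2, D.flip}, ∀ x, Z x ↔ Z (g x) := by
    intro g hg
    induction hg using Subgroup.closure_induction with
    | mem g hg =>
      rcases hg with rfl | rfl
      · refine fun x => ⟨hrot2 x, fun h => ?_⟩
        have := hrot2 _ h
        rw [pow_two, Equiv.Perm.mul_apply, D.rot_four] at this
        exact this
      · refine fun x => ⟨hflip x, fun h => ?_⟩
        have := hflip _ h
        rwa [D.flip_flip] at this
    | one => exact fun x => Iff.rfl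
    | mul g g' _ _ ih ih' => exact fun x => (ih' x).trans (ih _)
    | inv g _ ih =>
      intro x
      rw [ih (g⁻¹ x), ← Equiv.Perm.mul_apply, mul_inv_cancel, Equiv.Perm.one_apply]
  obtain ⟨g, hg, rfl⟩ := D.single_component x₀ x
  exact ((hall g hg x₀).1 hZ₀).resolve_right fun ⟨n, hn⟩ => hw hn hf

/-- The black corners of a state are determined by the crossings that it matches with black
faces. -/
theorem mem_of_matchedCrossings_eq (C : D.Checkerboard) {M' : Set H} (hM : D.IsState r s M)
    (hM' : D.IsState r s M') (hrs : D.OnSameSquare r s) (hr : C.black r)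
    (h : C.matchedCrossings M = C.matchedCrossings M') {x : H} (hx : x ∈ M)
    (hb : C.black (D.face x)) : x ∈ M' := by
  have hA := C.isBranching_of_isState hM
  have hA' := C.isBranching_of_isState hM'
  have hl := fun f => C.exists_level_of_isState hM hrs hr (f := f)
  have hl' := fun f => C.exists_level_of_isState hM' hrs hr (f := f)
  have hxK : D.crossing x ∈ C.matchedCrossings M := ⟨x, hx, rfl, hb⟩
  -- If the states use opposite corners here, each end of the edge is joined to `r` without it, one
  -- by each state; this would close a cycle.
  refine ((C.covers_blackCorners M') x hb (h ▸ hxK)).elim And.left fun hx' => ?_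
  have h1 := hA.reachable_parent ⟨hx, hb⟩ (hl _ hb)
  have h2 := hA'.reachable_parent hx' (hl' _ hx'.2)
  rw [crossing_rot_rot, D.rot_four, ← h] at h2
  exact absurd (h2.symm.trans h1) ((hA.isTree (C.covers_blackCorners M) hr hl).acyclic
    |>.not_reachable_deleteEdges (restrict_isLink hb hxK))

theorem subset_of_matchedCrossings_eq (C : D.Checkerboard) {M' : Set H} (hM : D.IsState r s M)
    (hM' : D.IsState r s M') (hrs : D.OnSameSquare r s) (hr : C.black r)
    (h : C.matchedCrossings M = C.matchedCrossings M') : M ⊆ M' := by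
  intro x hx
  by_cases hb : C.black (D.face x)
  · exact C.mem_of_matchedCrossings_eq hM hM' hrs hr h hx hb
  · refine C.swap.mem_of_matchedCrossings_eq hM.symm hM'.symm hrs.symm
      (C.not_black_of_onSameSquare hrs hr) ?_ hx hb
    rw [C.matchedCrossings_swap hM', ← h, C.matchedCrossings_swap hM]

/-- Every spanning tree comes from a state: direct the tree away from `r` and the dual tree away
from `s`. -/
theorem exists_isState (hrs : D.OnSameSquare r s) (hr : C.black r) {K : Set D.Crossing}
    (hT : (C.taitGraph.restrict K).IsTree) :
    ∃ M, D.IsState r s M ∧ C.matchedCrossings M = K := by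
  have hs := C.not_black_of_onSameSquare hrs hr
  obtain ⟨A, hA, hAf, hAl⟩ := exists_isBranching (C := C) fun f hf => hT.connected r hr f hf
  have hAc := hA.covers hT.acyclic hAl
  obtain ⟨B, hB, hBf, hBl⟩ := exists_isBranching (C := C.swap) (r := s) (K := Kᶜ)
    fun f hf => hA.reachable_dual hAc hr hAl hrs hf
  have hface : ∀ x ∈ A ∪ B, D.face x ≠ r ∧ D.face x ≠ s := by
    rintro x (hx | hx)
    · exact ⟨hA.ne_root x hx, fun h => hs (h ▸ hA.black x hx)⟩
    · exact ⟨fun h => hB.black x hx (h ▸ hr), hB.ne_root x hx⟩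
  have hfaceU : ∀ f, f ≠ r → f ≠ s → ∃! x, x ∈ A ∪ B ∧ D.face x = f := by
    intro f hfr hfs
    by_cases hf : C.black f
    · obtain ⟨x, hx, rfl⟩ := hAf f hf hfr
      refine ⟨x, ⟨.inl hx, rfl⟩, ?_⟩
      rintro y ⟨hy | hy, hxy⟩
      · exact hA.eq_of_face_eq y hy x hx hxy
      · exact absurd (hxy ▸ hf) (hB.black y hy)
    · obtain ⟨x, hx, rfl⟩ := hBf f hf hfs
      refine ⟨x, ⟨.inr hx, rfl⟩, ?_⟩
      rintro y ⟨hy | hy, hxy⟩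
      · exact absurd (hxy ▸ hA.black y hy) hf
      · exact hB.eq_of_face_eq y hy x hx hxy
  -- Corners of different colors lie at crossings in `K` and outside `K`, respectively.
  have hinj : Function.Injective fun x : ↥(A ∪ B) => D.crossing x := by
    rintro ⟨x, hx⟩ ⟨y, hy⟩ (h : D.crossing x = D.crossing y)
    refine Subtype.ext (?_ : x = y)
    by_contra hne
    rcases hx with hx | hx <;> rcases hy with hy | hy
    · obtain ⟨n, hn⟩ := hAl _ (hA.black x hx)
      exact hA.crossing_ne hx hy hn hne h
    · exact hB.crossing_mem y hy (h ▸ hA.crossing_mem x hx)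
    · exact hB.crossing_mem x hx (h.symm ▸ hA.crossing_mem y hy)
    · obtain ⟨n, hn⟩ := hBl _ (hB.black x hx)
      exact hB.crossing_ne hx hy hn hne h
  -- One corner for each face except `r` and `s`. The count shows that every crossing is used, so
  -- acyclicity of the dual graph need not be proved.
  have hcard : Nat.card ↥(A ∪ B) = Nat.card D.Crossing := by
    have := D.finite_face
    have h1 : Nat.card ↥(A ∪ B) = Nat.card ↥({r, s} : Set D.Face)ᶜ := by
      refine Nat.card_eq_of_bijective (fun x => ⟨D.face x, by simpa using hface x x.2⟩) ⟨?_, ?_⟩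
      · intro x y h
        have h' : D.face x = D.face y := congrArg Subtype.val h
        have hx := hface x x.2
        exact Subtype.ext ((hfaceU _ hx.1 hx.2).unique ⟨x.2, rfl⟩ ⟨y.2, h'.symm⟩)
      · rintro ⟨f, hf⟩
        obtain ⟨x, ⟨hx, hxf⟩, -⟩ := hfaceU f (by rintro rfl; simp at hf) (by rintro rfl; simp at hf)
        exact ⟨⟨x, hx⟩, Subtype.ext hxf⟩
    have h2 := Set.ncard_add_ncard_compl ({r, s} : Set D.Face)
    rw [Set.ncard_pair (fun h : r = s => hs (h ▸ hr)), D.card_face] at h2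
    rw [h1, Nat.card_coe_set_eq]
    lia
  have := D.finite_crossing
  have hbij := (Nat.bijective_iff_injective_and_card _).2 ⟨hinj, hcard⟩
  refine ⟨A ∪ B, ⟨hface, fun c => ?_, hfaceU⟩, ?_⟩
  · obtain ⟨x, hx⟩ := hbij.2 c
    refine ⟨x, ⟨x.2, hx⟩, fun y hy => ?_⟩
    exact congrArg Subtype.val (@hinj ⟨y, hy.1⟩ x (hy.2.trans hx.symm))
  · ext c
    constructor
    · rintro ⟨x, hx | hx, rfl, hb⟩
      · exact hA.crossing_mem x hx
      · exact absurd hb (hB.black x hx)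
    · intro hc
      obtain ⟨x, rfl, hb⟩ := C.exists_black_corner c
      rcases hAc x hb hc with hx | hx
      · exact ⟨x, .inl hx, rfl, hb⟩
      · exact ⟨_, .inl hx, crossing_rot_rot x, hA.black _ hx⟩

end Checkerboard

end KnotDiagram

/-! ### The bijection. -/

theorem Graph.IsSpanningSubgraph.eq_restrict {α β : Type*} {T G : Graph α β}
    (h : T.IsSpanningSubgraph G) : T = G.restrict E(T) := by
  refine Graph.Compatible.ext h.vertexSet_eq ?_ (.of_le_le h.le Graph.restrict_le)
  have := Graph.IsSubgraph.edgeSet_mono h.le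
  simpa using this

theorem Graph.RootedSpanningTree.ext {α β : Type*} {G : Graph α β} {T T' : G.RootedSpanningTree}
    (h : E(T.tree) = E(T'.tree)) (hr : T.root = T'.root) : T = T' := by
  have ht : T.tree = T'.tree := by
    rw [T.spanning.eq_restrict, h, ← T'.spanning.eq_restrict]
  cases T
  cases T'
  simp_all

/-- The spanning tree of a state: its edges are the crossings matched with a black face. -/
def KnotDiagram.Checkerboard.stateTree {H : Type*} {D : KnotDiagram H} (C : D.Checkerboard)
    {r s : D.Face} (hr : C.black r) (hrs : D.OnSameSquare r s) {M : Set H}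
    (hM : D.IsState r s M) : C.taitGraph.RootedSpanningTree where
  tree := C.taitGraph.restrict (C.matchedCrossings M)
  root := r
  spanning := C.restrict_isSpanningSubgraph _
  isTree := (C.isBranching_of_isState hM).isTree (C.covers_blackCorners M) hr
    fun _ => C.exists_level_of_isState hM hrs hr
  root_mem := hr

theorem proposition3p5 {H : Type*} (D : KnotDiagram H) (C : D.Checkerboard)
    (r s : D.Face) (hr : C.black r) (hrs : D.OnSameSquare r s) :
    ∃ Φ : {M : Set H // (D.balancedOverlaidTaitGraph r s).IsPerfectMatching M} ≃
        {T : C.taitGraph.RootedSpanningTree // T.root = r},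
      ∀ M,
        (∀ c : D.Crossing, c ∈ (Φ M).1.tree.edgeSet ↔
          ∃ x ∈ M.1, D.crossing x = c ∧ C.black (D.face x)) ∧
        (∀ x ∈ M.1, C.black (D.face x) →
          ((Φ M).1.tree.deleteEdges {D.crossing x}).Reachable r (D.face (D.rot (D.rot x)))) := by
  have hst (M : {M : Set H // (D.balancedOverlaidTaitGraph r s).IsPerfectMatching M}) :
      D.IsState r s M.1 := KnotDiagram.isPerfectMatching_iff_isState.1 M.2
  let φ : {M : Set H // (D.balancedOverlaidTaitGraph r s).IsPerfectMatching M} →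
      {T : C.taitGraph.RootedSpanningTree // T.root = r} :=
    fun M => ⟨C.stateTree hr hrs (hst M), rfl⟩
  have hφ : ∀ M, E((φ M).1.tree) = C.matchedCrossings M.1 :=
    fun M => C.edgeSet_restrict_taitGraph _
  have hbij : Function.Bijective φ := by
    constructor
    · intro M M' h
      have hK : C.matchedCrossings M.1 = C.matchedCrossings M'.1 := by rw [← hφ, h, hφ]
      exact Subtype.ext (Set.Subset.antisymm
        (C.subset_of_matchedCrossings_eq (hst M) (hst M') hrs hr hK)
        (C.subset_of_matchedCrossings_eq (hst M') (hst M) hrs hr hK.symm))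
    · rintro ⟨T, hT⟩
      obtain ⟨M, hM, hK⟩ := KnotDiagram.Checkerboard.exists_isState hrs hr
        (T.spanning.eq_restrict ▸ T.isTree)
      refine ⟨⟨M, KnotDiagram.isPerfectMatching_iff_isState.2 hM⟩, Subtype.ext ?_⟩
      exact Graph.RootedSpanningTree.ext ((hφ _).trans hK) hT.symm
  refine ⟨Equiv.ofBijective φ hbij, fun M => ⟨fun c => ?_, fun x hx hb => ?_⟩⟩
  · exact Set.ext_iff.1 (hφ M) c
  · exact (C.isBranching_of_isState (hst M)).reachable_parent ⟨hx, hb⟩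
      (C.exists_level_of_isState (hst M) hrs hr hb)
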